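/- All graphs are finite, undirected and simple. In the zero-visibility $k$-search game on a graph $G$, an invisible intruder starts at a vertex of $G$. The searcher inspects a set of at most $k$ vertices and wins if the intruder is at one of them; otherwise the intruder stays put or moves to an adjacent vertex, unseen, and the searcher inspects again, and so on. The inspection number $\mathsf{in}(G)$ is the minimum $k$ for which some finite sequence of inspections is guaranteed to catch the intruder. Subdividing an edge $vw$ means replacing it by two edges $vu$, $uw$, where $u$ is a new vertex; a subdivision of $G$ is a graph obtained from $G$ by a finite, possibly empty, sequence of edge subdivisions. The topological inspection number $\mathsf{in}_t(G)$ is the minimum $k$ such that every subdivision $H$ of $G$ has a further subdivision $H'$ with $\mathsf{in}(H') \le k$. A path decomposition of $G$ is a finite sequence $X_1, \dots, X_\ell$ of sets of vertices such that every edge has both ends in some $X_i$, and $v \in X_i \cap X_k$ implies $v \in X_j$ whenever $i < j < k$; its width is $\max_i |X_i| - 1$ (and $0$ if this is negative or the sequence is empty), and the pathwidth $\mathsf{pw}(G)$ is the minimum width of a path decomposition of $G$. **Theorem.** 1. For every tree $T$, $\mathsf{in}_t(T) \le 3$. 2. Equivalently, for every tree $T$ and every $\ell \in \mathbb{N}$,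 there is a subdivision $H$ of $T$ with $\mathsf{in}(H) \le 3$ in which every edge of $T$ is subdivided at least $\ell$ times. 3. Consequently, for every $n \in \mathbb{N}$ there is a graph $H$ with $\mathsf{in}(H) = 3$ and $\mathsf{pw}(H) \ge n$. -/

import Mathlib

universe u

namespace SimpleGraph

/-- The searcher has a winning strategy in the zero-visibility `k`-search game on `G`: a finite
sequence `S 0, …, S (ℓ - 1)` of vertex sets of size at most `k` such that every intruder, who
between two consecutive inspections stays put or moves to an adjacent vertex, is found. -/
def Searchable {V : Type u} (G : SimpleGraph V) (k : ℕ) : Prop :=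
  ∃ (ℓ : ℕ) (S : ℕ → Finset V), (∀ t < ℓ, (S t).card ≤ k) ∧
    ∀ p : ℕ → V, (∀ t, p (t + 1) = p t ∨ G.Adj (p t) (p (t + 1))) → ∃ t < ℓ, p t ∈ S t

/-- The inspection number: the minimum `k` such that the searcher wins the `k`-search game
(it would be `⊤` if there were no such `k`, which does not happen for finite graphs). -/
noncomputable def inspectionNumber {V : Type u} (G : SimpleGraph V) : ℕ∞ :=
  ⨅ (k : ℕ) (_ : G.Searchable k), (k : ℕ∞)

/-- The graph obtained from `G` by subdividing the edge `vw`: the new vertex `none` is joined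
to `v` and `w`, and the edge `vw` is removed. -/
def subdivideEdge {V : Type u} (G : SimpleGraph V) (v w : V) : SimpleGraph (Option V) where
  Adj
    | some a, some b => G.Adj a b ∧ s(a, b) ≠ s(v, w)
    | some a, none => a = v ∨ a = w
    | none, some b => b = v ∨ b = w
    | none, none => False
  symm := ⟨by
    rintro (_ | a) (_ | b) h
    · exact h
    · exact h
    · exact h
    · exact ⟨h.1.symm, fun e => h.2 (Sym2.eq_swap.trans e)⟩⟩
  loopless := ⟨by
    rintro (_ | a) h
    · exact h
    · exact G.loopless.irrefl a h.1⟩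

/-- `H` is obtained from `G`, up to isomorphism, by a finite (possibly empty) sequence of edge
subdivisions, and `φ` sends every vertex of `G` to the corresponding vertex of `H`. -/
inductive IsSubdivisionVia {V : Type u} (G : SimpleGraph V) :
    {W : Type u} → SimpleGraph W → (V → W) → Prop
  | iso {W : Type u} {H : SimpleGraph W} (e : G ≃g H) : IsSubdivisionVia G H (fun x => e x)
  | step {W W' : Type u} {H : SimpleGraph W} {H' : SimpleGraph W'} {φ : V → W} {v w : W}
      (hH : IsSubdivisionVia G H φ) (hvw : H.Adj v w) (e : H.subdivideEdge v w ≃g H') :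
      IsSubdivisionVia G H' (fun x => e (some (φ x)))

/-- `H` is a subdivision of `G`. -/
def IsSubdivision {V W : Type u} (G : SimpleGraph V) (H : SimpleGraph W) : Prop :=
  ∃ φ : V → W, IsSubdivisionVia G H φ

/-- The topological inspection number: the minimum `k` such that every subdivision `H` of `G`
has a further subdivision `H'` of inspection number at most `k`. -/
noncomputable def topInspectionNumber {V : Type u} (G : SimpleGraph V) : ℕ∞ :=
  ⨅ (k : ℕ) (_ : ∀ (W : Type u) (H : SimpleGraph W), G.IsSubdivision H →
      ∃ (W' : Type u) (H' : SimpleGraph W'), H.IsSubdivision H' ∧ H'.inspectionNumber ≤ k),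
    (k : ℕ∞)

/-- In the subdivision `H` of `G`, in which `φ` locates the vertices of `G`, every edge of `G`
is subdivided at least `ℓ` times. The path that replaces the edge `uv` is the path of `H` from
`φ u` to `φ v` with no vertex of `G` in its interior; if `uv` is subdivided `n` times, then it has
length `n + 1`. -/
def EdgesSubdivided {V W : Type u} (G : SimpleGraph V) (H : SimpleGraph W) (φ : V → W)
    (ℓ : ℕ) : Prop :=
  ∀ u v : V, G.Adj u v → ∃ p : H.Walk (φ u) (φ v), p.IsPath ∧
    (∀ x : V, φ x ∈ p.support → x = u ∨ x = v) ∧ ℓ + 1 ≤ p.length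

/-- `X 0, …, X (ℓ - 1)` is a path decomposition of `G`. -/
def IsPathDecomposition {V : Type u} (G : SimpleGraph V) {ℓ : ℕ} (X : Fin ℓ → Finset V) : Prop :=
  (∀ a b : V, G.Adj a b → ∃ i, a ∈ X i ∧ b ∈ X i) ∧
    ∀ i j k : Fin ℓ, i < j → j < k → ∀ v : V, v ∈ X i → v ∈ X k → v ∈ X j

/-- The width of a path decomposition: the maximum size of a bag, minus one (and `0` if there
is no bag). -/
def pathDecompositionWidth {V : Type u} {ℓ : ℕ} (X : Fin ℓ → Finset V) : ℕ :=
  (Finset.univ.sup fun i => (X i).card) - 1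

/-- The pathwidth of a finite graph: the minimum width of a path decomposition. -/
noncomputable def pathwidth {V : Type u} (G : SimpleGraph V) : ℕ :=
  sInf {n : ℕ | ∃ (ℓ : ℕ) (X : Fin ℓ → Finset V),
    G.IsPathDecomposition X ∧ pathDecompositionWidth X = n}

end SimpleGraph

/-!
A tree is searched with three inspected vertices per step once the lengths of its subdivided edges
are chosen suitably. Root the tree and list its vertices in depth-first postorder; the *leg* of `v`
is the subdivided edge from `v` to its parent. Two inspected vertices sweep a leg from its lower to
its upper end, and a third one can guard the upper end meanwhile. Process the vertices in
postorder, where processing `v` consists of sweeping the legs of its children, the latest child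
first, with `v` guarded, and of then sweeping the leg of `v` itself. After that last sweep the
intruder creeps back into the leg of `v` from above, one vertex per step, until the parent of `v`
is processed, when the leg is swept a second time under guard and is clean for good. Everything is
fine if the intruder never reaches the lower end `v` in between. In postorder, all sweeps in
between are first or second sweeps of legs of vertices later than `v`; so it is enough that every
leg is more than twice as long as all later legs together, and lengths that decrease geometrically
along the postorder do this. The sweep is `PostOrder.clears_sweep`, the bookkeeping of the lengths
is `PostOrder.budget`, and the search is assembled in `PostOrder.searchable_legGraph`.

Every finite tree has a postorder (`IsTree.nonempty_postOrder`), and subdivisions inherit one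
(`PostOrder.nonempty_of_isSubdivisionVia`), which yields the bound for the topological inspection
number.

Pathwidth is unbounded on subdivided trees: joining a new root to three copies of a tree forces
larger bags (`HasLargeBags.tripleJoin`), since the bags that meet a connected set form an interval,
and subdividing does not help (`PostOrder.hasLargeBags_legGraph`), since a subdivision is contracted
to the original tree leg by leg. A disjoint triangle rules out searches with fewer than three
inspected vertices.
-/

/-! ### The search game and subdivided rooted trees -/

namespace SimpleGraph

variable {V : Type u} {G : SimpleGraph V} {k : ℕ}

/-- Starting from knowledge that the intruder is outside `A`, finitely many inspections of at most
`k` vertices each either find the intruder or guarantee that it is outside `B`. -/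
def Clears (G : SimpleGraph V) (k : ℕ) (A B : Set V) : Prop :=
  ∃ (ℓ : ℕ) (S : ℕ → Finset V), (∀ t < ℓ, (S t).card ≤ k) ∧
    ∀ p : ℕ → V, (∀ t, p (t + 1) = p t ∨ G.Adj (p t) (p (t + 1))) → p 0 ∉ A →
      (∀ t < ℓ, p t ∉ S t) → p ℓ ∉ B

theorem Clears.of_subset {A B : Set V} (h : B ⊆ A) : G.Clears k A B :=
  ⟨0, fun _ => ∅, by simp, fun _ _ h0 _ hB => h0 (h hB)⟩

theorem Clears.trans {A B C : Set V} (h₁ : G.Clears k A B) (h₂ : G.Clears k B C) :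
    G.Clears k A C := by
  obtain ⟨ℓ₁, S₁, hc₁, H₁⟩ := h₁
  obtain ⟨ℓ₂, S₂, hc₂, H₂⟩ := h₂
  refine ⟨ℓ₁ + ℓ₂, fun t => if t < ℓ₁ then S₁ t else S₂ (t - ℓ₁), ?_, ?_⟩
  · intro t ht
    dsimp only
    split_ifs with h
    · exact hc₁ t h
    · exact hc₂ _ (by omega)
  · intro p hp h0 hS
    refine H₂ (fun t => p (ℓ₁ + t)) (fun t => hp (ℓ₁ + t)) ?_ ?_
    · refine H₁ p hp h0 fun t ht => ?_
      simpa [ht] using hS t (by omega)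
    · intro t ht
      simpa using hS (ℓ₁ + t) (by omega)

theorem Clears.step {A B : Set V} (S : Finset V) (hS : S.card ≤ k)
    (h : ∀ y ∈ B, (y ∈ A ∨ y ∈ S) ∧ ∀ x, G.Adj x y → x ∈ A ∨ x ∈ S) : G.Clears k A B := by
  refine ⟨1, fun _ => S, fun _ _ => hS, fun p hp h0 hS hB => ?_⟩
  have h0' : p 0 ∉ S := hS 0 one_pos
  rcases hp 0 with e | e
  · rw [zero_add] at e
    have := (h _ hB).1
    rw [e] at this
    tauto
  · have := (h _ hB).2 _ e
    tauto

theorem Clears.searchable (h : G.Clears k ∅ Set.univ) : G.Searchable k := by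
  obtain ⟨ℓ, S, hc, H⟩ := h
  refine ⟨ℓ, S, hc, fun p hp => ?_⟩
  by_contra! hcon
  exact H p hp (Set.notMem_empty _) hcon (Set.mem_univ _)

theorem Searchable.inspectionNumber_le (h : G.Searchable k) : G.inspectionNumber ≤ k :=
  iInf₂_le k h

/-- A presentation of a rooted tree in which the vertices are listed in depth-first postorder:
`par v` is the parent of `v`, `ord v` is the position of `v`, and the intervals from `v` to `par v`
are laminar. The value `par root` is irrelevant. -/
structure PostOrder (G : SimpleGraph V) where
  root : V
  par : V → V
  ord : V → ℕ
  ord_inj : Function.Injective ord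
  lt_par : ∀ v, v ≠ root → ord v < ord (par v)
  le_root : ∀ v, ord v ≤ ord root
  adj_iff : ∀ a b, G.Adj a b ↔ (a ≠ root ∧ par a = b) ∨ (b ≠ root ∧ par b = a)
  laminar : ∀ c u, c ≠ root → u ≠ root → ord c < ord u → ord u < ord (par c) →
    ord (par u) ≤ ord (par c)

namespace PostOrder

variable (P : G.PostOrder) (L : V → ℕ)

/-- The subdivision of a rooted tree in which the edge from `v` to its parent has `L v` inner
vertices: `(v, 0)` is the vertex `v` itself, and `(v, 1), …, (v, L v)` lie on the way from `v` to
its parent. -/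
def legGraph : SimpleGraph {x : V × ℕ // x.2 ≤ L x.1} :=
  let up (x y : V × ℕ) : Prop :=
    (y.1 = x.1 ∧ y.2 = x.2 + 1) ∨ (x.1 ≠ P.root ∧ x.2 = L x.1 ∧ y.1 = P.par x.1 ∧ y.2 = 0)
  { Adj := fun x y => up x.1 y.1 ∨ up y.1 x.1
    symm := ⟨fun _ _ h => h.symm⟩
    loopless := ⟨by
      rintro ⟨⟨v, i⟩, hi⟩ h
      have h := or_self_iff.1 h
      simp only [Nat.left_eq_add, one_ne_zero, and_false, false_or, up] at h
      have := P.lt_par v h.1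
      rw [← h.2.2.1] at this
      exact this.false⟩ }

theorem legGraph_adj (x y : {x : V × ℕ // x.2 ≤ L x.1}) : (P.legGraph L).Adj x y ↔
    ((y.1.1 = x.1.1 ∧ y.1.2 = x.1.2 + 1) ∨
      (x.1.1 ≠ P.root ∧ x.1.2 = L x.1.1 ∧ y.1.1 = P.par x.1.1 ∧ y.1.2 = 0)) ∨
    ((x.1.1 = y.1.1 ∧ x.1.2 = y.1.2 + 1) ∨
      (y.1.1 ≠ P.root ∧ y.1.2 = L y.1.1 ∧ x.1.1 = P.par y.1.1 ∧ x.1.2 = 0)) :=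
  Iff.rfl

/-- The vertices of the subdivided tree that are known to be clean when the first `f v` vertices
of every leg `v` are. -/
def cleanSet (f : V → ℕ) : Set {x : V × ℕ // x.2 ≤ L x.1} := {x | x.1.2 < f x.1.1}

theorem mem_cleanSet {f : V → ℕ} {x : {x : V × ℕ // x.2 ≤ L x.1}} :
    x ∈ cleanSet L f ↔ x.1.2 < f x.1.1 := Iff.rfl

variable {L}

open Classical in
/-- The sweep of the leg of `c`, from `c` to its parent, with the parent inspected all the time.
The legs in `K` are entirely clean and stay so, since wherever such a leg is attached is clean or
inspected; on all other legs the intruder regains one vertex per step. -/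
theorem clears_sweep {f : V → ℕ} {c : V} {K : Set V} (hc : c ≠ P.root) (hcK : c ∉ K)
    (hK : ∀ u ∈ K, P.par u ∈ K ∨ P.par u = P.par c ∨ P.par u = c ∨ L c < f (P.par u))
    (hch : ∀ d, d ≠ P.root → (P.par d = c ∨ P.par d ∈ K ∨ 0 < f (P.par d)) → d ∈ K)
    (hfL : ∀ u, f u ≤ L u + 1) (hfK : ∀ u ∈ K, f u = L u + 1) :
    (P.legGraph L).Clears 3 (cleanSet L f)
      (cleanSet L fun u => if u = c then L c + 1 else if u ∈ K then L u + 1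
        else f u - (L c + 1)) := by
  set F : ℕ → V → ℕ := fun s u => if u = c then s else if u ∈ K then L u + 1 else f u - s with hF
  have key : ∀ s ≤ L c + 1, (P.legGraph L).Clears 3 (cleanSet L f) (cleanSet L (F s)) := by
    intro s
    induction s with
    | zero =>
      refine fun _ => Clears.of_subset fun x hx => ?_
      rw [mem_cleanSet] at hx ⊢
      simp only [hF] at hx
      split_ifs at hx with h1 h2
      · omega
      · rw [hfK _ h2]; omega
      · omega
    | succ s ih =>
      intro hs
      refine (ih (by omega)).trans (Clears.step
        {⟨(c, s), by simpa using hs⟩, ⟨(c, min (s + 1) (L c)), by simp⟩,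
          ⟨(P.par c, 0), Nat.zero_le _⟩} Finset.card_le_three ?_)
      have hchild : ∀ d, d ≠ P.root → P.par d = c ∨ P.par d ∈ K ∨ 0 < f (P.par d) →
          F s d = L d + 1 := by
        intro d hd h
        have hdK := hch d hd h
        have hdc : d ≠ c := fun e => hcK (e ▸ hdK)
        simp [hF, hdc, hdK]
      have hcs : ∀ s, F s c = s := by simp [hF]
      have hKs : ∀ u ∈ K, u ≠ c ∧ ∀ s, F s u = L u + 1 := by
        intro u hu
        have huc : u ≠ c := fun e => hcK (e ▸ hu)
        simp [hF, huc, hu]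
      have hos : ∀ u, u ≠ c → u ∉ K → ∀ s, F s u = f u - s := by
        intro u huc hu s
        simp [hF, huc, hu]
      rintro ⟨⟨u, i⟩, hi⟩ hy
      rw [mem_cleanSet] at hy
      simp only [mem_cleanSet, Finset.mem_insert, Finset.mem_singleton,
        Subtype.mk.injEq, Prod.mk.injEq] at hy hi ⊢
      have hpar : ∀ u ∈ K, 0 < F s (P.par u) ∨ P.par u = P.par c ∨ (P.par u = c ∧ s = 0) := by
        intro u hu
        by_cases h1 : P.par u = c
        · rw [h1, hcs]
          rcases Nat.eq_zero_or_pos s with h | h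
          · exact Or.inr (Or.inr ⟨rfl, h⟩)
          · exact Or.inl h
        by_cases h2 : P.par u ∈ K
        · rw [(hKs _ h2).2]; omega
        · rw [hos _ h1 h2]
          rcases hK u hu with h | h | h | h
          · exact absurd h h2
          · exact Or.inr (Or.inl h)
          · exact absurd h h1
          · omega
      by_cases huc : u = c
      · subst huc
        rw [hcs] at hy
        refine ⟨?_, ?_⟩
        · rw [hcs]
          rcases Nat.lt_succ_iff_lt_or_eq.1 hy with h | h
          · exact Or.inl h
          · exact Or.inr (Or.inl ⟨rfl, h⟩)
        rintro ⟨⟨v, j⟩, hj⟩ hadj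
        rw [legGraph_adj] at hadj
        simp only [Subtype.mk.injEq, Prod.mk.injEq] at hadj hj ⊢
        rcases hadj with (⟨rfl, rfl⟩ | ⟨h1, h2, h3, h4⟩) | (⟨rfl, rfl⟩ | ⟨h1, h2, h3, h4⟩)
        · rw [hcs]; omega
        · left
          rw [hchild v h1 (Or.inl h3.symm)]; omega
        · rw [hcs]
          by_cases h : i = s
          · right; right; left; exact ⟨rfl, by omega⟩
          · rcases Nat.lt_or_ge (i + 1) s with h' | h'
            · exact Or.inl h'
            · right; left; exact ⟨rfl, by omega⟩
        · exact Or.inr (Or.inr (Or.inr ⟨h3, h4⟩))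
      by_cases huK : u ∈ K
      · refine ⟨?_, ?_⟩
        · rw [(hKs u huK).2]; omega
        rintro ⟨⟨v, j⟩, hj⟩ hadj
        rw [legGraph_adj] at hadj
        simp only [Subtype.mk.injEq, Prod.mk.injEq] at hadj hj ⊢
        rcases hadj with (⟨rfl, rfl⟩ | ⟨h1, h2, h3, h4⟩) | (⟨rfl, rfl⟩ | ⟨h1, h2, h3, h4⟩)
        · rw [(hKs _ huK).2]; omega
        · left
          rw [hchild v h1 (Or.inr (Or.inl (h3 ▸ huK)))]; omega
        · rw [(hKs _ huK).2]; omega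
        · subst h3 h4
          rcases hpar u huK with h | h | ⟨h, h'⟩
          · exact Or.inl h
          · exact Or.inr (Or.inr (Or.inr ⟨h, rfl⟩))
          · exact Or.inr (Or.inl ⟨h, h'.symm⟩)
      · rw [hos u huc huK] at hy
        have hu := hfL u
        refine ⟨?_, ?_⟩
        · rw [hos u huc huK]; omega
        rintro ⟨⟨v, j⟩, hj⟩ hadj
        rw [legGraph_adj] at hadj
        simp only [Subtype.mk.injEq, Prod.mk.injEq] at hadj hj ⊢
        rcases hadj with (⟨rfl, rfl⟩ | ⟨h1, h2, h3, h4⟩) | (⟨rfl, rfl⟩ | ⟨h1, h2, h3, h4⟩)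
        · rw [hos _ huc huK]; omega
        · left
          rw [hchild v h1 (Or.inr (Or.inr (h3 ▸ by omega)))]; omega
        · rw [hos _ huc huK]; omega
        · omega
  simpa [hF] using key (L c + 1) le_rfl

end PostOrder

end SimpleGraph

/-! ### The search of a subdivided rooted tree -/

namespace SimpleGraph.PostOrder

variable {V : Type u} {G : SimpleGraph V}

variable (T : G.PostOrder)

open Classical in
/-- Leg lengths that decrease geometrically along the postorder, and are at least `M` except for the
root, which has no leg. -/
noncomputable def geomLength (M : ℕ) (v : V) : ℕ :=
  if v = T.root then 0 else (M + 1) * 3 ^ (T.ord T.root - T.ord v) - 1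

theorem geomLength_root (M : ℕ) : T.geomLength M T.root = 0 := by
  simp [geomLength]

theorem geomLength_add_one {M : ℕ} {v : V} (h : v ≠ T.root) :
    T.geomLength M v + 1 = (M + 1) * 3 ^ (T.ord T.root - T.ord v) := by
  have : 0 < (M + 1) * 3 ^ (T.ord T.root - T.ord v) := by positivity
  simp only [geomLength, h, if_false]
  omega

theorem le_geomLength {M : ℕ} {v : V} (h : v ≠ T.root) : M ≤ T.geomLength M v := by
  have h1 := T.geomLength_add_one (M := M) h
  have : 1 ≤ 3 ^ (T.ord T.root - T.ord v) := Nat.one_le_pow _ _ (by norm_num)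
  nlinarith

open Classical in
/-- The state of the search when every leg in `P` has been swept once and every leg in `Q` has been
swept with its upper end guarded. The legs in `Q` are clean for good. A leg in `P` but not in `Q`
is being lost again, and the guaranteed clean part of it has one vertex more than the number of
steps taken by all first sweeps and by the second sweeps of later legs that are still to come. -/
noncomputable def budget [Fintype V] (L : V → ℕ) (P Q : Set V) (u : V) : ℕ :=
  if u ∈ Q then L u + 1
  else if u ∈ P then
    1 + (∑ k with k ∉ P, (L k + 1) + ∑ k with k ∉ Q ∧ T.ord u < T.ord k, (L k + 1))
  else 0

variable [Fintype V] {L : V → ℕ} {P Q : Set V}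

theorem budget_of_mem {u : V} (h : u ∈ Q) : T.budget L P Q u = L u + 1 := by
  simp [budget, h]

open Classical in
theorem budget_of_mem_of_notMem {u : V} (hP : u ∈ P) (hQ : u ∉ Q) : T.budget L P Q u =
    1 + (∑ k with k ∉ P, (L k + 1) + ∑ k with k ∉ Q ∧ T.ord u < T.ord k, (L k + 1)) := by
  simp [budget, hP, hQ]

theorem budget_of_notMem {u : V} (hP : u ∉ P) (hQ : u ∉ Q) : T.budget L P Q u = 0 := by
  simp [budget, hP, hQ]

theorem lt_budget_of_notMem_left {u c : V} (hP : u ∈ P) (hQ : u ∉ Q) (hc : c ∉ P) :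
    L c + 1 < T.budget L P Q u := by
  classical
  rw [T.budget_of_mem_of_notMem hP hQ]
  have := Finset.single_le_sum (f := fun k => L k + 1) (s := Finset.univ.filter (· ∉ P))
    (fun _ _ => Nat.zero_le _) (by simpa using hc)
  omega

theorem lt_budget_of_notMem_right {u c : V} (hP : u ∈ P) (hQ : u ∉ Q) (hc : c ∉ Q)
    (huc : T.ord u < T.ord c) : L c + 1 < T.budget L P Q u := by
  classical
  rw [T.budget_of_mem_of_notMem hP hQ]
  have := Finset.single_le_sum (f := fun k => L k + 1)
    (s := Finset.univ.filter fun k => k ∉ Q ∧ T.ord u < T.ord k)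
    (fun _ _ => Nat.zero_le _) (by simpa using ⟨hc, huc⟩)
  omega

/-- Sweeping one more leg for the first time uses up its length from the budget of the others. -/
theorem budget_insert_left {u c : V} (hP : u ∈ P) (hQ : u ∉ Q) (hc : c ∉ P) :
    T.budget L (insert c P) Q u + (L c + 1) = T.budget L P Q u := by
  classical
  obtain ⟨P', hP'⟩ : ∃ P', P' = insert c P := ⟨_, rfl⟩
  rw [← hP', T.budget_of_mem_of_notMem hP hQ,
    T.budget_of_mem_of_notMem (hP' ▸ Set.mem_insert_of_mem _ hP) hQ]
  have : Finset.univ.filter (· ∉ P) = insert c (Finset.univ.filter (· ∉ P')) := by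
    ext k
    simp only [Finset.mem_filter, Finset.mem_univ, true_and, Finset.mem_insert, hP',
      Set.mem_insert_iff]
    by_cases h : k = c <;> simp_all
  rw [this, Finset.sum_insert (by simp [hP'])]
  omega

/-- Sweeping one more leg for the second time uses up its length from the budget of the legs that
come earlier in the order. -/
theorem budget_insert_right {u c : V} (hP : u ∈ P) (hQ : u ∉ Q) (hc : c ∉ Q)
    (huc : T.ord u < T.ord c) :
    T.budget L P (insert c Q) u + (L c + 1) = T.budget L P Q u := by
  classical
  obtain ⟨Q', hQ'⟩ : ∃ Q', Q' = insert c Q := ⟨_, rfl⟩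
  have huQ : u ∉ Q' := by
    rw [hQ']
    rintro (rfl | h)
    · exact huc.false
    · exact hQ h
  rw [← hQ', T.budget_of_mem_of_notMem hP hQ, T.budget_of_mem_of_notMem hP huQ]
  have : (Finset.univ.filter fun k => k ∉ Q ∧ T.ord u < T.ord k) =
      insert c (Finset.univ.filter fun k => k ∉ Q' ∧ T.ord u < T.ord k) := by
    ext k
    simp only [Finset.mem_filter, Finset.mem_univ, true_and, Finset.mem_insert, hQ',
      Set.mem_insert_iff]
    by_cases h : k = c <;> simp_all
  rw [this, Finset.sum_insert (by simp [hQ'])]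
  omega

open Classical in
/-- If every leg is more than twice as long as all later legs together, then a leg never has to be
longer than it is to sustain its budget. -/
theorem budget_le (hL : ∀ u, u ≠ T.root →
      1 + 2 * ∑ k with T.ord u < T.ord k, (L k + 1) ≤ L u + 1)
    (hP : ∀ u ∈ P, u ≠ T.root ∧ ∀ v, T.ord v < T.ord u → v ∈ P) (u : V) :
    T.budget L P Q u ≤ L u + 1 := by
  by_cases hQ : u ∈ Q
  · rw [T.budget_of_mem hQ]
  by_cases hu : u ∈ P
  · rw [T.budget_of_mem_of_notMem hu hQ]
    have h1 : ∑ k with k ∉ P, (L k + 1) ≤ ∑ k with T.ord u < T.ord k, (L k + 1) := by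
      refine Finset.sum_le_sum_of_subset fun k => ?_
      simp only [Finset.mem_filter, Finset.mem_univ, true_and]
      intro hk
      by_contra h
      rcases lt_or_eq_of_le (not_lt.1 h) with h | h
      · exact hk ((hP u hu).2 k h)
      · exact hk (T.ord_inj h ▸ hu)
    have h2 : ∑ k with k ∉ Q ∧ T.ord u < T.ord k, (L k + 1) ≤
        ∑ k with T.ord u < T.ord k, (L k + 1) := by
      refine Finset.sum_le_sum_of_subset fun k => ?_
      simp only [Finset.mem_filter, Finset.mem_univ, true_and]
      exact And.right
    have := hL u (hP u hu).1
    omega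
  · rw [T.budget_of_notMem hu hQ]; omega

open Classical in
/-- The first sweep of the leg of `c`, when all vertices before `c` have been processed. -/
theorem clears_first_sweep (hL : ∀ u, u ≠ T.root →
      1 + 2 * ∑ k with T.ord u < T.ord k, (L k + 1) ≤ L u + 1) {c : V} (hc : c ≠ T.root)
    (hP : P = {u | T.ord u < T.ord c})
    (hQ : Q = {u | u ≠ T.root ∧ T.ord (T.par u) ≤ T.ord c}) :
    (T.legGraph L).Clears 3 (cleanSet L (T.budget L P Q))
      (cleanSet L (T.budget L (insert c P) Q)) := by
  have hlt := T.lt_par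
  have hcP : c ∉ P := by simp [hP]
  have hcQ : c ∉ Q := by
    rw [hQ]; rintro ⟨-, h⟩; exact absurd (hlt c hc) (by omega)
  have hQP : Q ⊆ P := by
    rw [hQ, hP]; rintro u ⟨h, h'⟩; exact (hlt u h).trans_le h'
  have hroot : ∀ u ∈ P, u ≠ T.root := by
    rw [hP]; rintro u h rfl
    exact absurd (T.le_root c) (not_le.2 h)
  have hPdown : ∀ u ∈ P, u ≠ T.root ∧ ∀ v, T.ord v < T.ord u → v ∈ P := by
    refine fun u hu => ⟨hroot u hu, ?_⟩
    rw [hP] at hu ⊢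
    exact fun v hv => hv.trans hu
  refine (T.clears_sweep (K := Q) hc hcQ ?_ ?_ (T.budget_le hL hPdown)
    fun u hu => T.budget_of_mem hu).trans (Clears.of_subset ?_)
  · intro u hu
    by_cases h : T.par u = c
    · exact Or.inr (Or.inr (Or.inl h))
    by_cases h' : T.par u ∈ Q
    · exact Or.inl h'
    right; right; right
    have : T.par u ∈ P := by
      rw [hQ] at hu; rw [hP]
      exact lt_of_le_of_ne hu.2 fun e => h (T.ord_inj e)
    have := T.lt_budget_of_notMem_left (L := L) this h' hcP
    omega
  · intro d hd h
    have : T.par d = c ∨ T.par d ∈ P := by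
      rcases h with h | h | h
      · exact Or.inl h
      · exact Or.inr (hQP h)
      · by_contra hcon
        rw [not_or] at hcon
        rw [T.budget_of_notMem hcon.2 fun h => hcon.2 (hQP h)] at h
        exact h.false
    rw [hQ]
    refine ⟨hd, ?_⟩
    rcases this with h | h
    · rw [h]
    · rw [hP] at h; exact le_of_lt h
  · intro x hx
    rw [mem_cleanSet] at hx ⊢
    refine hx.trans_le ?_
    generalize x.1.1 = u
    split_ifs with h1 h2
    · subst h1
      refine T.budget_le hL (fun v hv => ?_) u
      rcases hv with rfl | hv
      · exact ⟨hc, fun w hw => Or.inr (by rw [hP]; exact hw)⟩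
      · exact ⟨hroot v hv, fun w hw => Or.inr ((hPdown v hv).2 w hw)⟩
    · rw [T.budget_of_mem h2]
    · by_cases hu : u ∈ P
      · have := T.budget_insert_left (L := L) hu h2 hcP
        omega
      · rw [T.budget_of_notMem (by simp [h1, hu]) h2]; omega

open Classical in
/-- The second sweep of the leg of `c`, with its parent guarded, when the parent is the next vertex
to be processed and the legs of the later children of the parent have been swept again. -/
theorem clears_second_sweep (hL : ∀ u, u ≠ T.root →
      1 + 2 * ∑ k with T.ord u < T.ord k, (L k + 1) ≤ L u + 1) {c : V} (hc : c ≠ T.root)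
    (hP : P = {u | T.ord u < T.ord (T.par c)})
    (hQ : Q = {u | u ≠ T.root ∧ (T.ord (T.par u) < T.ord (T.par c) ∨
      T.ord (T.par u) = T.ord (T.par c) ∧ T.ord c < T.ord u)}) :
    (T.legGraph L).Clears 3 (cleanSet L (T.budget L P Q))
      (cleanSet L (T.budget L P (insert c Q))) := by
  have hlt := T.lt_par
  have hcP : c ∈ P := by rw [hP]; exact hlt c hc
  have hcQ : c ∉ Q := by
    rw [hQ]; rintro ⟨-, h⟩; omega
  have hQP : Q ⊆ P := by
    rw [hQ, hP]; rintro u ⟨h, h'⟩; have := hlt u h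
    show T.ord u < _
    omega
  have hroot : ∀ u ∈ P, u ≠ T.root := by
    rw [hP]; rintro u h rfl
    exact absurd (T.le_root (T.par c)) (not_le.2 h)
  have hPdown : ∀ u ∈ P, u ≠ T.root ∧ ∀ v, T.ord v < T.ord u → v ∈ P := by
    refine fun u hu => ⟨hroot u hu, ?_⟩
    rw [hP] at hu ⊢
    exact fun v hv => hv.trans hu
  -- By laminarity, all legs between `c` and its parent have been swept twice.
  have hopen : ∀ u ∈ P, u ∉ Q → u ≠ c → T.ord u < T.ord c := by
    intro u hu huQ huc
    have hur := hroot u hu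
    by_contra h
    have h := lt_of_le_of_ne (not_lt.1 h) fun e => huc (T.ord_inj e.symm)
    have hle := T.laminar c u hc hur h (by rw [hP] at hu; exact hu)
    refine huQ ?_
    rw [hQ]
    exact ⟨hur, hle.lt_or_eq.imp_right fun e => ⟨e, h⟩⟩
  refine (T.clears_sweep (K := Q) hc hcQ ?_ ?_ (T.budget_le hL hPdown)
    fun u hu => T.budget_of_mem hu).trans (Clears.of_subset ?_)
  · intro u hu
    by_cases h1 : T.par u = c
    · exact Or.inr (Or.inr (Or.inl h1))
    by_cases h2 : T.par u ∈ Q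
    · exact Or.inl h2
    by_cases h3 : T.par u = T.par c
    · exact Or.inr (Or.inl h3)
    right; right; right
    have hm : T.par u ∈ P := by
      rw [hQ] at hu; rw [hP]
      exact hu.2.resolve_right fun e => h3 (T.ord_inj e.1)
    have := T.lt_budget_of_notMem_right (L := L) hm h2 hcQ (hopen _ hm h2 h1)
    omega
  · intro d hd h
    have : T.par d ∈ P := by
      rcases h with h | h | h
      · exact h ▸ hcP
      · exact hQP h
      · by_contra hcon
        rw [T.budget_of_notMem hcon fun h => hcon (hQP h)] at h
        exact h.false
    rw [hQ]
    refine ⟨hd, Or.inl ?_⟩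
    rw [hP] at this; exact this
  · intro x hx
    rw [mem_cleanSet] at hx ⊢
    refine hx.trans_le ?_
    generalize x.1.1 = u
    split_ifs with h1 h2
    · rw [T.budget_of_mem (by simp [h1]), h1]
    · rw [T.budget_of_mem (Set.mem_insert_of_mem _ h2)]
    · by_cases hu : u ∈ P
      · have := T.budget_insert_right (L := L) hu h2 hcQ (hopen u hu h2 h1)
        omega
      · rw [T.budget_of_notMem hu (by simp [h1, h2])]; omega

open Classical in
/-- The search processes the vertices in postorder. To process a vertex is to sweep the legs of its
children again, the latest child first, and then its own leg for the first time. -/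
theorem searchable_legGraph (hL : ∀ u, u ≠ T.root →
      1 + 2 * ∑ k with T.ord u < T.ord k, (L k + 1) ≤ L u + 1) (hr : L T.root = 0) :
    (T.legGraph L).Searchable 3 := by
  set P : ℕ → Set V := fun j => {u | T.ord u < j} with hP
  set Q : ℕ → ℕ → Set V := fun j m => {u | u ≠ T.root ∧ (T.ord (T.par u) < j ∨
    T.ord (T.par u) = j ∧ m ≤ T.ord u)} with hQ
  -- Sweep the legs of the children of the `j`-th vertex.
  have children : ∀ j m, m ≤ j → (T.legGraph L).Clears 3
      (cleanSet L (T.budget L (P j) (Q j m))) (cleanSet L (T.budget L (P j) (Q j 0))) := by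
    intro j m
    induction m with
    | zero => exact fun _ => Clears.of_subset subset_rfl
    | succ m ih =>
      intro hm
      refine Clears.trans ?_ (ih (by omega))
      by_cases h : ∃ c, c ≠ T.root ∧ T.ord c = m ∧ T.ord (T.par c) = j
      · obtain ⟨c, hc, rfl, rfl⟩ := h
        have : Q (T.ord (T.par c)) (T.ord c) = insert c (Q (T.ord (T.par c)) (T.ord c + 1)) := by
          ext u
          simp only [hQ, Set.mem_ofPred_eq, Set.mem_insert_iff]
          by_cases h : u = c
          · subst h; simp [hc]
          · have : T.ord u ≠ T.ord c := fun e => h (T.ord_inj e)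
            simp only [h, false_or]
            refine and_congr_right fun _ => ?_
            omega
        rw [this]
        exact T.clears_second_sweep hL hc rfl rfl
      · have : Q j m = Q j (m + 1) := by
          ext u
          simp only [hQ, Set.mem_ofPred_eq]
          refine and_congr_right fun hu => ?_
          have : ¬ (T.ord u = m ∧ T.ord (T.par u) = j) := fun e => h ⟨u, hu, e⟩
          omega
        rw [this]
        exact Clears.of_subset subset_rfl
  have stage : ∀ j ≤ T.ord T.root, (T.legGraph L).Clears 3 ∅
      (cleanSet L (T.budget L (P j) (Q j j))) := by
    intro j
    induction j with
    | zero =>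
      refine fun _ => Clears.of_subset fun x hx => ?_
      rw [mem_cleanSet, T.budget_of_notMem] at hx
      · exact absurd hx (by simp)
      · simp [hP]
      · simp only [hQ, Set.mem_ofPred_eq]
        rintro ⟨h, h'⟩
        have := T.lt_par _ h
        omega
    | succ j ih =>
      intro hj
      have hQ' : Q (j + 1) (j + 1) = Q j 0 := by
        ext u
        simp only [hQ, Set.mem_ofPred_eq]
        refine and_congr_right fun hu => ?_
        have := T.lt_par u hu
        omega
      rw [hQ']
      refine (ih (by omega)).trans ((children j j le_rfl).trans ?_)
      by_cases h : ∃ c, T.ord c = j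
      · obtain ⟨c, rfl⟩ := h
        have : P (T.ord c + 1) = insert c (P (T.ord c)) := by
          ext u
          simp only [hP, Set.mem_ofPred_eq, Set.mem_insert_iff, ← T.ord_inj.eq_iff]
          omega
        rw [this]
        refine T.clears_first_sweep hL (by rintro rfl; omega) rfl ?_
        ext u
        simp only [hQ, Set.mem_ofPred_eq]
        refine and_congr_right fun hu => ?_
        omega
      · have : P (j + 1) = P j := by
          ext u
          have : T.ord u ≠ j := fun e => h ⟨u, e⟩
          simp only [hP, Set.mem_ofPred_eq]
          omega
        rw [this]
        exact Clears.of_subset subset_rfl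
  refine Clears.searchable ((stage _ le_rfl).trans ((children _ _ le_rfl).trans
    (Clears.step {⟨(T.root, 0), Nat.zero_le _⟩} (by simp) ?_)))
  have : ∀ x : {x : V × ℕ // x.2 ≤ L x.1},
      x ∈ cleanSet L (T.budget L (P (T.ord T.root)) (Q (T.ord T.root) 0)) ∨
      x ∈ ({⟨(T.root, 0), Nat.zero_le _⟩} : Finset {x : V × ℕ // x.2 ≤ L x.1}) := by
    rintro ⟨⟨u, i⟩, hi⟩
    by_cases hu : u = T.root
    · subst hu
      right
      simp only [Finset.mem_singleton, Subtype.mk.injEq, Prod.mk.injEq, true_and]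
      simpa [hr] using hi
    · left
      rw [mem_cleanSet, T.budget_of_mem]
      · exact Nat.lt_succ_of_le hi
      · have := T.le_root (T.par u)
        simp only [hQ, Set.mem_ofPred_eq]
        exact ⟨hu, by omega⟩
  exact fun y _ => ⟨this y, fun x _ => this x⟩

open Classical in
theorem geomLength_sum_le (M : ℕ) (u : V) (hu : u ≠ T.root) :
    1 + 2 * ∑ k with T.ord u < T.ord k, (T.geomLength M k + 1) ≤ T.geomLength M u + 1 := by
  set a := T.ord T.root - T.ord u with ha
  have hle : ∀ k, T.geomLength M k + 1 ≤ (M + 1) * 3 ^ (T.ord T.root - T.ord k) := by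
    intro k
    by_cases h : k = T.root
    · subst h; simp [geomLength]
    · exact (T.geomLength_add_one h).le
  have h1 : ∑ k with T.ord u < T.ord k, (T.geomLength M k + 1) ≤
      ∑ e ∈ Finset.range a, (M + 1) * 3 ^ e := by
    refine (Finset.sum_le_sum fun k _ => hle k).trans ?_
    rw [← Finset.sum_image (g := fun k => T.ord T.root - T.ord k) (f := fun e => (M + 1) * 3 ^ e)]
    · refine Finset.sum_le_sum_of_subset fun e => ?_
      simp only [Finset.mem_image, Finset.mem_filter, Finset.mem_univ, true_and, Finset.mem_range]
      rintro ⟨k, hk, rfl⟩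
      have := T.le_root k
      omega
    · intro k _ k' _ h
      have h1 := T.le_root k
      have h2 := T.le_root k'
      dsimp only at h
      exact T.ord_inj (by omega)
  have h3 : ∀ a, 2 * ∑ e ∈ Finset.range a, 3 ^ e + 1 = 3 ^ a := by
    intro a
    induction a with
    | zero => simp
    | succ n ih => rw [Finset.sum_range_succ, pow_succ]; omega
  rw [T.geomLength_add_one hu, ← ha, ← h3 a]
  rw [← Finset.mul_sum] at h1
  nlinarith

end SimpleGraph.PostOrder

/-! ### Postorders and subdivisions -/

namespace SimpleGraph

variable {V : Type u} {G : SimpleGraph V}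

theorem subdivideEdge_comm (v w : V) : G.subdivideEdge v w = G.subdivideEdge w v := by
  ext a b
  rcases a with _ | a <;> rcases b with _ | b
  · rfl
  · exact or_comm
  · exact or_comm
  · show G.Adj a b ∧ s(a, b) ≠ s(v, w) ↔ G.Adj a b ∧ s(a, b) ≠ s(w, v)
    rw [Sym2.eq_swap (a := v)]

namespace PostOrder

/-- Lengthening one leg by one vertex is an edge subdivision. -/
noncomputable def subdivideLegIso (T : G.PostOrder) {L L' : V → ℕ} {v : V} (hv : v ≠ T.root)
    (hne : ∀ u, u ≠ v → L' u = L u) (hL : L' v = L v + 1) :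
    (T.legGraph L).subdivideEdge ⟨(v, L v), le_rfl⟩ ⟨(T.par v, 0), Nat.zero_le _⟩ ≃g
      T.legGraph L' where
  toFun
    | some x => ⟨x.1, x.2.trans (by
        by_cases h : x.1.1 = v
        · rw [h, hL]; omega
        · rw [hne _ h])⟩
    | none => ⟨(v, L v + 1), hL.ge⟩
  invFun x := open Classical in
    if h : x.1.2 ≤ L x.1.1 then some ⟨x.1, h⟩ else none
  left_inv := by
    rintro (_ | ⟨x, hx⟩)
    · simp
    · simp [hx]
  right_inv := by
    rintro ⟨⟨u, i⟩, hi⟩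
    by_cases h : i ≤ L u
    · simp [h]
    · simp only [h, dite_false, Subtype.mk.injEq, Prod.mk.injEq]
      have huv : u = v := by
        by_contra hcon
        exact h (hne u hcon ▸ hi)
      subst huv
      exact ⟨rfl, by dsimp only at hi; omega⟩
  map_rel_iff' := by
    have hlt := T.lt_par v hv
    have hpv : T.par v ≠ v := fun e => by rw [e] at hlt; exact hlt.false
    rintro (_ | ⟨⟨a, i⟩, hi⟩) (_ | ⟨⟨b, j⟩, hj⟩)
    · simp [legGraph_adj, subdivideEdge]
    · simp only [legGraph_adj, subdivideEdge, Equiv.coe_fn_mk, Subtype.mk.injEq, Prod.mk.injEq]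
      have := hne b
      grind
    · simp only [legGraph_adj, subdivideEdge, Equiv.coe_fn_mk, Subtype.mk.injEq, Prod.mk.injEq]
      have := hne a
      grind
    · simp only [subdivideEdge, Equiv.coe_fn_mk, legGraph_adj, ne_eq, Sym2.eq_iff,
        Subtype.mk.injEq, Prod.mk.injEq]
      have := hne a
      have := hne b
      have := T.lt_par a
      have := T.lt_par b
      grind

theorem isSubdivisionVia_legGraph [Finite V] (T : G.PostOrder) {L : V → ℕ} (hr : L T.root = 0) :
    G.IsSubdivisionVia (T.legGraph L) fun x => ⟨(x, 0), Nat.zero_le _⟩ := by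
  classical
  have := Fintype.ofFinite V
  induction hn : ∑ v, L v generalizing L with
  | zero =>
    have hL : ∀ v, L v = 0 := by simpa using hn
    let e : G ≃g T.legGraph L := by
      refine ⟨⟨fun x => ⟨(x, 0), Nat.zero_le _⟩, fun x => x.1.1, fun _ => rfl, ?_⟩, ?_⟩
      · rintro ⟨⟨v, i⟩, hi⟩
        have := hL v
        simp only [Subtype.mk.injEq, Prod.mk.injEq, true_and]
        dsimp only at hi
        omega
      · intro a b
        simp only [Equiv.coe_fn_mk, legGraph_adj, T.adj_iff, hL]
        simp [eq_comm]
    exact IsSubdivisionVia.iso e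
  | succ n ih =>
    obtain ⟨v, hv⟩ : ∃ v, L v ≠ 0 := by
      by_contra! hcon
      simp [hcon] at hn
    have hvr : v ≠ T.root := by rintro rfl; exact hv hr
    have h0 := ih (L := Function.update L v (L v - 1)) (by simp [hvr.symm, hr]) (by
      rw [Finset.sum_update_of_mem (Finset.mem_univ v)]
      have := Finset.sum_eq_add_sum_sdiff_singleton_of_mem (Finset.mem_univ v) L
      omega)
    exact h0.step (by simp [legGraph_adj, hvr])
      (T.subdivideLegIso (L' := L) hvr (fun u hu => by simp [hu]) (by simp; omega))

/-- The path that replaces the edge from `u` to its parent. -/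
theorem exists_path_legGraph (T : G.PostOrder) {L : V → ℕ} {u : V} (hu : u ≠ T.root) :
    ∃ p : (T.legGraph L).Walk ⟨(u, 0), Nat.zero_le _⟩ ⟨(T.par u, 0), Nat.zero_le _⟩, p.IsPath ∧
      (∀ x ∈ p.support, x.1.1 = u ∨ x = ⟨(T.par u, 0), Nat.zero_le _⟩) ∧ p.length = L u + 1 := by
  have hlt := T.lt_par u hu
  have hpu : T.par u ≠ u := fun e => by rw [e] at hlt; exact hlt.false
  have key : ∀ n (hn : n ≤ L u), ∃ p : (T.legGraph L).Walk ⟨(u, L u - n), by simp⟩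
      ⟨(T.par u, 0), Nat.zero_le _⟩, p.IsPath ∧
      (∀ x ∈ p.support, (x.1.1 = u ∧ L u - n ≤ x.1.2) ∨ x = ⟨(T.par u, 0), Nat.zero_le _⟩) ∧
      p.length = n + 1 := by
    intro n
    induction n with
    | zero =>
      refine fun _ => ⟨Walk.cons (by simp [legGraph_adj, hu]) Walk.nil, ?_, ?_, rfl⟩
      · simp [hpu.symm]
      · simp
    | succ n ih =>
      intro hn
      obtain ⟨p, hp, hs, hl⟩ := ih (by omega)
      refine ⟨Walk.cons (by simp [legGraph_adj]; omega) p, ?_, ?_, by simp [hl]⟩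
      · rw [Walk.cons_isPath_iff]
        refine ⟨hp, fun hmem => ?_⟩
        rcases hs _ hmem with h | h
        · have := h.2
          dsimp only at this
          omega
        · simp [hpu.symm] at h
      · intro x hx
        rw [Walk.support_cons, List.mem_cons] at hx
        rcases hx with rfl | hx
        · exact Or.inl ⟨rfl, le_rfl⟩
        · exact (hs x hx).imp_left fun h => ⟨h.1, by omega⟩
  obtain ⟨p, hp, hs, hl⟩ := key (L u) le_rfl
  refine ⟨p.copy (by simp) rfl, ?_, ?_, by simpa using hl⟩
  · simpa using hp
  · intro x hx
    rw [Walk.support_copy] at hx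
    exact (hs x hx).imp_left And.left

theorem edgesSubdivided_legGraph (T : G.PostOrder) {L : V → ℕ} {M : ℕ}
    (hL : ∀ u, u ≠ T.root → M ≤ L u) :
    G.EdgesSubdivided (T.legGraph L) (fun x => ⟨(x, 0), Nat.zero_le _⟩) M := by
  intro a b hab
  rcases (T.adj_iff a b).1 hab with ⟨h, rfl⟩ | ⟨h, rfl⟩
  · obtain ⟨p, hp, hs, hl⟩ := T.exists_path_legGraph (L := L) h
    refine ⟨p, hp, fun x hx => (hs _ hx).imp_right fun e => ?_, by have := hL a h; omega⟩
    simpa using e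
  · obtain ⟨p, hp, hs, hl⟩ := T.exists_path_legGraph (L := L) h
    refine ⟨p.reverse, hp.reverse, fun x hx => ?_, by have := hL b h; simp; omega⟩
    rw [Walk.support_reverse, List.mem_reverse] at hx
    rcases hs _ hx with e | e
    · exact Or.inr e
    · left; simpa using e

theorem inspectionNumber_legGraph_le [Finite V] (T : G.PostOrder) (M : ℕ) :
    (T.legGraph (T.geomLength M)).inspectionNumber ≤ 3 := by
  have := Fintype.ofFinite V
  exact (T.searchable_legGraph (T.geomLength_sum_le M) (T.geomLength_root M)).inspectionNumber_le

/-- Transport of a postorder along an isomorphism. -/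
def ofIso {W : Type*} {H : SimpleGraph W} (T : G.PostOrder) (e : G ≃g H) : H.PostOrder where
  root := e T.root
  par w := e (T.par (e.symm w))
  ord w := T.ord (e.symm w)
  ord_inj := T.ord_inj.comp e.symm.injective
  lt_par w hw := by
    simpa using T.lt_par (e.symm w) fun h => hw (by rw [← h]; simp)
  le_root w := by simpa using T.le_root (e.symm w)
  adj_iff a b := by
    rw [← e.symm.map_adj_iff, T.adj_iff]
    have h : ∀ w, e.symm w = T.root ↔ w = e T.root := fun w => e.toEquiv.symm_apply_eq
    have h' : ∀ x w, x = e.symm w ↔ e x = w := fun x w => e.toEquiv.eq_symm_apply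
    simp only [ne_eq, h, h']
  laminar c u hc hu h1 h2 := by
    have h : ∀ w, w ≠ e T.root → e.symm w ≠ T.root := fun w hw h => hw (by rw [← h]; simp)
    simpa using T.laminar _ _ (h c hc) (h u hu) h1 (by simpa using h2)

open Classical in
/-- When the edge from `v` to its parent is subdivided, the new vertex comes directly after `v`. -/
noncomputable def subdivide (T : G.PostOrder) {v : V} (hv : v ≠ T.root) :
    (G.subdivideEdge v (T.par v)).PostOrder where
  root := some T.root
  par
    | none => some (T.par v)
    | some u => if u = v then none else some (T.par u)
  ord
    | none => 2 * T.ord v + 1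
    | some u => 2 * T.ord u
  ord_inj := by
    rintro (_ | a) (_ | b) h
    · rfl
    · dsimp only at h; omega
    · dsimp only at h; omega
    · rw [T.ord_inj (a₁ := a) (a₂ := b) (by dsimp only at h; omega)]
  lt_par := by
    rintro (_ | u) hu
    · have := T.lt_par v hv
      dsimp only
      omega
    · have := T.lt_par u (by simpa using hu)
      by_cases h : u = v
      · subst h; simp
      · simp [h, this]
  le_root := by
    rintro (_ | u)
    · have := T.lt_par v hv
      have := T.le_root (T.par v)
      dsimp only
      omega
    · have := T.le_root u
      dsimp only
      omega
  adj_iff := by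
    have hlt := T.lt_par v hv
    have hpv : T.par v ≠ v := fun e => by rw [e] at hlt; exact hlt.false
    rintro (_ | a) (_ | b)
    · simp [subdivideEdge]
    · simp only [subdivideEdge]
      by_cases h : b = v
      · subst h; simp [hv]
      · simp [h, eq_comm]
    · simp only [subdivideEdge]
      by_cases h : a = v
      · subst h; simp [hv]
      · simp [h, eq_comm]
    · simp only [subdivideEdge, T.adj_iff, ne_eq, Sym2.eq_iff, Option.some.injEq]
      have hlta := T.lt_par a
      have hltb := T.lt_par b
      grind
  laminar := by
    rintro (_ | c) (_ | u) hc hu h1 h2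
    · exact le_rfl
    · have hu : u ≠ T.root := fun e => hu (congrArg some e)
      have huv : u ≠ v := by rintro rfl; dsimp only at h1; omega
      have := T.laminar v u hv hu (by dsimp only at h1; omega) (by dsimp only at h2; omega)
      simpa [huv] using this
    · have hc : c ≠ T.root := fun e => hc (congrArg some e)
      by_cases h : c = v
      · simp [h] at h2
      · have hne : T.ord c ≠ T.ord v := fun e => h (T.ord_inj e)
        simp only [h, if_false] at h1 h2 ⊢
        have := T.laminar c v hc hv (by omega) (by omega)
        omega
    · have hc : c ≠ T.root := fun e => hc (congrArg some e)
      have hu : u ≠ T.root := fun e => hu (congrArg some e)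
      by_cases h : c = v
      · simp only [h, if_true] at h1 h2
        omega
      · simp only [h, if_false] at h1 h2 ⊢
        by_cases h' : u = v
        · subst h'
          simp only [if_true]
          omega
        · simp only [h', if_false]
          have := T.laminar c u hc hu (by omega) (by omega)
          omega

theorem nonempty_of_isSubdivisionVia {W : Type u} {H : SimpleGraph W} {φ : V → W}
    (T : G.PostOrder) (h : G.IsSubdivisionVia H φ) : Nonempty H.PostOrder := by
  induction h with
  | iso e => exact ⟨T.ofIso e⟩
  | @step W W' H H' φ v w hH hvw e ih =>
    obtain ⟨S⟩ := ih
    rcases (S.adj_iff v w).1 hvw with ⟨h, rfl⟩ | ⟨h, rfl⟩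
    · exact ⟨(S.subdivide h).ofIso e⟩
    · rw [subdivideEdge_comm] at e
      exact ⟨(S.subdivide h).ofIso e⟩

end PostOrder

theorem IsSubdivisionVia.finite {W : Type u} {H : SimpleGraph W} {φ : V → W} [Finite V]
    (h : G.IsSubdivisionVia H φ) : Finite W := by
  induction h with
  | iso e => exact Finite.of_equiv _ e.toEquiv
  | step _ _ e ih => exact Finite.of_equiv _ e.toEquiv

end SimpleGraph

/-! ### Postorders of trees -/

namespace SimpleGraph

variable {V : Type u} {G : SimpleGraph V}

namespace PostOrder

/-- A leaf can be added to a postorder directly before its neighbour. -/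
theorem nonempty_of_leaf {x : V} (S : (G.induce ({x}ᶜ : Set V)).PostOrder)
    (y : ({x}ᶜ : Set V)) (hxy : ∀ z, G.Adj x z ↔ z = y) : Nonempty G.PostOrder := by
  classical
  obtain ⟨ord, hox, ho⟩ : ∃ ord : V → ℕ,
      ord x = 2 * S.ord y ∧ ∀ z : ({x}ᶜ : Set V), ord z = 2 * S.ord z + 1 :=
    ⟨fun v => if h : v = x then 2 * S.ord y else 2 * S.ord ⟨v, h⟩ + 1, by simp,
      fun z => dif_neg z.2⟩
  obtain ⟨par, hpx, hp⟩ : ∃ par : V → V, par x = y ∧ ∀ z : ({x}ᶜ : Set V), par z = S.par z :=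
    ⟨fun v => if h : v = x then y else S.par ⟨v, h⟩, by simp, fun z => dif_neg z.2⟩
  have hcases : ∀ v, v = x ∨ ∃ z : ({x}ᶜ : Set V), v = z := fun v =>
    (em (v = x)).imp_right fun h => ⟨⟨v, h⟩, rfl⟩
  have hne : ∀ z : ({x}ᶜ : Set V), z.1 ≠ x := fun z => z.2
  have hroot : ∀ {z : ({x}ᶜ : Set V)}, z.1 ≠ S.root.1 → z ≠ S.root :=
    fun h e => h (congrArg Subtype.val e)
  refine ⟨⟨S.root, par, ord, ?_, ?_, ?_, ?_, ?_⟩⟩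
  · intro a b h
    rcases hcases a with rfl | ⟨a, rfl⟩ <;> rcases hcases b with rfl | ⟨b, rfl⟩
    · rfl
    · rw [hox, ho] at h; omega
    · rw [hox, ho] at h; omega
    · rw [ho, ho] at h
      rw [S.ord_inj (a₁ := a) (a₂ := b) (by omega)]
  · intro v hv
    rcases hcases v with rfl | ⟨v, rfl⟩
    · rw [hpx, hox, ho]; omega
    · have := S.lt_par v (hroot hv)
      rw [hp, ho, ho]; omega
  · intro v
    rcases hcases v with rfl | ⟨v, rfl⟩
    · have := S.le_root y
      rw [hox, ho]; omega
    · have := S.le_root v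
      rw [ho, ho]; omega
  · intro a b
    rcases hcases a with rfl | ⟨a, rfl⟩ <;> rcases hcases b with rfl | ⟨b, rfl⟩
    · simp [hpx, hne]
    · simp [hxy, hpx, hp, hne, (hne _).symm, eq_comm]
    · rw [G.adj_comm]
      simp [hxy, hpx, hp, hne, (hne _).symm, eq_comm]
    · have := S.adj_iff a b
      simp only [comap_adj, Function.Embedding.subtype_apply, ne_eq, Subtype.ext_iff] at this
      simp [this, hp]
  · intro c u hc hu h1 h2
    rcases hcases c with rfl | ⟨c, rfl⟩ <;> rcases hcases u with rfl | ⟨u, rfl⟩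
    · exact le_rfl
    · rw [hox, ho] at h1
      rw [hpx, ho, ho] at h2
      omega
    · rw [hp, hox, ho] at h2
      rw [hpx, hp, ho, ho]
      omega
    · rw [ho, ho] at h1
      rw [hp, ho, ho] at h2
      have := S.laminar c u (hroot hc) (hroot hu) (by omega) (by omega)
      rw [hp, hp, ho, ho]
      omega

end PostOrder

theorem IsTree.nonempty_postOrder [Finite V] (hG : G.IsTree) : Nonempty G.PostOrder := by
  induction hn : Nat.card V using Nat.strong_induction_on generalizing V with
  | _ n ih =>
    classical
    have := Fintype.ofFinite V
    have hne := hG.connected.nonempty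
    rcases subsingleton_or_nontrivial V with hs | hs
    · obtain ⟨r⟩ := hne
      exact ⟨⟨r, id, fun _ => 0, fun a b _ => Subsingleton.elim a b,
        fun v hv => (hv (Subsingleton.elim v r)).elim, fun _ => le_rfl,
        fun a b => by simp [Subsingleton.elim a r, Subsingleton.elim b r],
        fun c _ hc => (hc (Subsingleton.elim c r)).elim⟩⟩
    · obtain ⟨x, hx⟩ := hG.exists_vert_degree_one_of_nontrivial
      obtain ⟨y, hy, hu⟩ := degree_eq_one_iff_existsUnique_adj.1 hx
      have hT : (G.induce ({x}ᶜ : Set V)).IsTree :=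
        ⟨hG.connected.induce_compl_singleton_of_degree_eq_one hx, hG.isAcyclic.induce _⟩
      obtain ⟨S⟩ := ih (Nat.card ({x}ᶜ : Set V))
        (hn ▸ Finite.card_subtype_lt (p := (· ∈ ({x}ᶜ : Set V))) (x := x) (by simp)) hT rfl
      exact S.nonempty_of_leaf ⟨y, hy.ne'⟩ fun z => ⟨hu z, fun h => h ▸ hy⟩

theorem PostOrder.preconnected (T : G.PostOrder) : G.Preconnected := by
  have key : ∀ n v, T.ord T.root - T.ord v = n → G.Reachable v T.root := by
    intro n
    induction n using Nat.strong_induction_on with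
    | _ n ih =>
      rintro v rfl
      by_cases hv : v = T.root
      · rw [hv]
      · have h1 := T.lt_par v hv
        have h2 := T.le_root (T.par v)
        have hadj : G.Adj v (T.par v) := (T.adj_iff _ _).2 (Or.inl ⟨hv, rfl⟩)
        exact hadj.reachable.trans (ih _ (by omega) _ rfl)
  exact fun a b => (key _ a rfl).trans (key _ b rfl).symm

end SimpleGraph

/-! ### Pathwidth -/

namespace SimpleGraph

variable {V W : Type*} {G : SimpleGraph V} {H : SimpleGraph W}

/-- The bags that meet a connected set form an interval. -/
theorem IsPathDecomposition.exists_mem_of_preconnected {ℓ : ℕ} {X : Fin ℓ → Finset V}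
    (hX : G.IsPathDecomposition X) {C : Set V} (hC : (G.induce C).Preconnected)
    {i j k : Fin ℓ} (hij : i ≤ j) (hjk : j ≤ k) {a b : V} (ha : a ∈ C) (hai : a ∈ X i)
    (hb : b ∈ C) (hbk : b ∈ X k) : ∃ c ∈ C, c ∈ X j := by
  by_contra! hcon
  have hij : i < j := hij.lt_of_ne fun e => hcon a ha (e ▸ hai)
  have hjk : j < k := hjk.lt_of_ne fun e => hcon b hb (e ▸ hbk)
  have key : ∀ x : C, (G.induce C).Reachable ⟨a, ha⟩ x → ∃ s < j, x.1 ∈ X s := by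
    intro x hx
    rw [reachable_iff_reflTransGen] at hx
    induction hx with
    | refl => exact ⟨i, hij, hai⟩
    | @tail x y _ hxy ih =>
      obtain ⟨s, hs, hxs⟩ := ih
      obtain ⟨t, hxt, hyt⟩ := hX.1 x y hxy
      rcases lt_trichotomy t j with h | rfl | h
      · exact ⟨t, h, hyt⟩
      · exact (hcon x x.2 hxt).elim
      · exact (hcon x x.2 (hX.2 s j t hs h x hxs hxt)).elim
  obtain ⟨s, hs, hbs⟩ := key ⟨b, hb⟩ (hC _ _)
  exact hcon b hb (hX.2 s j k hs hjk b hbs hbk)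

/-- Every path decomposition of `G` has a bag with at least `n` vertices. -/
def HasLargeBags (G : SimpleGraph V) (n : ℕ) : Prop :=
  ∀ (ℓ : ℕ) (X : Fin ℓ → Finset V), G.IsPathDecomposition X → ∃ i, n ≤ (X i).card

theorem IsPathDecomposition.preimage {ℓ : ℕ} {X : Fin ℓ → Finset W}
    (hX : H.IsPathDecomposition X) (f : G →g H) (hf : Function.Injective f) :
    G.IsPathDecomposition fun i => (X i).preimage f hf.injOn := by
  refine ⟨fun a b hab => ?_, fun i j k hij hjk v hi hk => ?_⟩
  · simpa using hX.1 _ _ (f.map_adj hab)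
  · rw [Finset.mem_preimage] at hi hk ⊢
    exact hX.2 i j k hij hjk _ hi hk

theorem HasLargeBags.of_injective {n : ℕ} (h : G.HasLargeBags n) (f : G →g H)
    (hf : Function.Injective f) : H.HasLargeBags n := by
  classical
  intro ℓ X hX
  obtain ⟨i, hi⟩ := h ℓ _ (hX.preimage f hf)
  refine ⟨i, hi.trans ?_⟩
  rw [Finset.card_preimage]
  exact Finset.card_filter_le _ _

/-- Contracting connected sets of vertices to single vertices does not enlarge the bags of a path
decomposition. Here `π` maps every vertex of `H` to the vertex of `G` it is contracted to. -/
theorem HasLargeBags.of_contraction {n : ℕ} (h : G.HasLargeBags n) (π : W → V)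
    (hπ : ∀ v, (H.induce (π ⁻¹' {v})).Preconnected)
    (hadj : ∀ a b, G.Adj a b → ∃ x y, π x = a ∧ π y = b ∧ H.Adj x y) : H.HasLargeBags n := by
  classical
  intro ℓ X hX
  suffices hY : G.IsPathDecomposition fun i => (X i).image π by
    obtain ⟨i, hi⟩ := h ℓ _ hY
    exact ⟨i, hi.trans Finset.card_image_le⟩
  refine ⟨fun a b hab => ?_, fun i j k hij hjk v hi hk => ?_⟩
  · obtain ⟨x, y, rfl, rfl, hxy⟩ := hadj a b hab
    obtain ⟨i, hx, hy⟩ := hX.1 x y hxy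
    exact ⟨i, Finset.mem_image_of_mem _ hx, Finset.mem_image_of_mem _ hy⟩
  · rw [Finset.mem_image] at hi hk ⊢
    obtain ⟨x, hx, hxv⟩ := hi
    obtain ⟨y, hy, hyv⟩ := hk
    obtain ⟨z, hz, hzj⟩ := hX.exists_mem_of_preconnected (hπ v) hij.le hjk.le hxv hx hyv hy
    exact ⟨z, hzj, hz⟩

theorem HasLargeBags.le_pathwidth [Finite V] {n : ℕ} (h : G.HasLargeBags (n + 1)) :
    n ≤ G.pathwidth := by
  have := Fintype.ofFinite V
  refine le_csInf ⟨_, 1, fun _ => Finset.univ, ⟨fun a b _ => ⟨0, by simp⟩, by simp⟩, rfl⟩ ?_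
  rintro _ ⟨ℓ, X, hX, rfl⟩
  obtain ⟨i, hi⟩ := h ℓ X hX
  have := Finset.le_sup (f := fun i => (X i).card) (Finset.mem_univ i)
  rw [pathDecompositionWidth]
  omega

/-- Three disjoint copies of `G`, and a new vertex `none` joined to the three copies of `r`. -/
def tripleJoin (G : SimpleGraph V) (r : V) : SimpleGraph (Option (Fin 3 × V)) where
  Adj
    | some a, some b => a.1 = b.1 ∧ G.Adj a.2 b.2
    | some a, none => a.2 = r
    | none, some b => b.2 = r
    | none, none => False
  symm := ⟨by
    rintro (_ | a) (_ | b) h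
    · exact h
    · exact h
    · exact h
    · exact ⟨h.1.symm, h.2.symm⟩⟩
  loopless := ⟨by
    rintro (_ | a) h
    · exact h
    · exact G.loopless.irrefl a.2 h.2⟩

theorem HasLargeBags.tripleJoin {n : ℕ} (h : G.HasLargeBags n) (hn : 1 ≤ n)
    (hG : G.Preconnected) (r : V) : (G.tripleJoin r).HasLargeBags (n + 1) := by
  classical
  intro ℓ X hX
  let f : Fin 3 → (G →g G.tripleJoin r) := fun i => ⟨fun v => some (i, v), fun h => ⟨rfl, h⟩⟩
  have hf : ∀ i, Function.Injective (f i) := fun i a b h => by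
    simpa [f] using (show some (i, a) = some (i, b) from h)
  choose t ht using fun i => h ℓ _ (hX.preimage (f i) (hf i))
  -- Among the three copies, the one whose large bag comes second is separated from a connected
  -- set that meets all bags between the other two.
  obtain ⟨i, j, k, hij, hjk, h1, h2⟩ : ∃ i j k : Fin 3, i ≠ j ∧ k ≠ j ∧ t i ≤ t j ∧ t j ≤ t k := by
    rcases le_total (t 0) (t 1) with h01 | h01 <;> rcases le_total (t 1) (t 2) with h12 | h12 <;>
      rcases le_total (t 0) (t 2) with h02 | h02
    · exact ⟨0, 1, 2, by decide, by decide, h01, h12⟩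
    · exact ⟨0, 1, 2, by decide, by decide, h01, h12⟩
    · exact ⟨0, 2, 1, by decide, by decide, h02, h12⟩
    · exact ⟨2, 0, 1, by decide, by decide, h02, h01⟩
    · exact ⟨1, 0, 2, by decide, by decide, h01, h02⟩
    · exact ⟨1, 2, 0, by decide, by decide, h12, h02⟩
    · exact ⟨2, 1, 0, by decide, by decide, h12, h01⟩
    · exact ⟨2, 1, 0, by decide, by decide, h12, h01⟩
  set C : Set (Option (Fin 3 × V)) := {x | ∀ v, x ≠ some (j, v)} with hC
  have hnone : none ∈ C := by simp [hC]
  have hCr : ∀ x : C, ((G.tripleJoin r).induce C).Reachable x ⟨none, hnone⟩ := by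
    rintro ⟨_ | ⟨m, v⟩, hx⟩
    · rfl
    · have hm : m ≠ j := by rintro rfl; exact hx v rfl
      have hmC : ∀ w, some (m, w) ∈ C := fun w => by simp [hC, hm]
      let g : G →g (G.tripleJoin r).induce C := ⟨fun w => ⟨some (m, w), hmC w⟩, fun h => ⟨rfl, h⟩⟩
      refine ((hG v r).map g).trans (Adj.reachable ?_)
      exact (rfl : r = r)
  have hmeet : ∀ m, m ≠ j → ∃ x ∈ C, x ∈ X (t m) := by
    intro m hm
    obtain ⟨v, hv⟩ := Finset.card_pos.1 (hn.trans (ht m))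
    rw [Finset.mem_preimage] at hv
    exact ⟨_, fun w e => hm (congrArg Prod.fst (Option.some.inj e)), hv⟩
  obtain ⟨a, haC, ha⟩ := hmeet i hij
  obtain ⟨b, hbC, hb⟩ := hmeet k hjk
  obtain ⟨c, hcC, hc⟩ := hX.exists_mem_of_preconnected
    (fun x y => (hCr x).trans (hCr y).symm) h1 h2 haC ha hbC hb
  refine ⟨t j, ?_⟩
  rw [← Finset.card_erase_add_one hc]
  refine Nat.add_le_add_right ((ht j).trans ?_) 1
  rw [← Finset.card_image_of_injective _ (hf j)]
  refine Finset.card_le_card fun x hx => ?_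
  obtain ⟨v, hv, rfl⟩ := Finset.mem_image.1 hx
  exact Finset.mem_erase.2 ⟨fun e => hcC v e.symm, Finset.mem_preimage.1 hv⟩

namespace PostOrder

/-- The postorder of three copies of a rooted tree below a new root: one copy after the other, and
the new root at the end. -/
noncomputable def tripleJoin (T : G.PostOrder) : (G.tripleJoin T.root).PostOrder where
  root := none
  par
    | none => none
    | some (i, v) => open Classical in if v = T.root then none else some (i, T.par v)
  ord
    | none => 3 * (T.ord T.root + 1)
    | some (i, v) => i * (T.ord T.root + 1) + T.ord v
  ord_inj := by
    have hle := T.le_root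
    rintro (_ | ⟨i, v⟩) (_ | ⟨j, w⟩) h
    · rfl
    · have := hle w
      dsimp only at h
      fin_cases j <;> simp at h <;> omega
    · have := hle v
      dsimp only at h
      fin_cases i <;> simp at h <;> omega
    · have hv := hle v
      have hw := hle w
      have hij : i = j := by
        dsimp only at h
        fin_cases i <;> fin_cases j <;> simp at h ⊢ <;> omega
      subst hij
      rw [T.ord_inj (a₁ := v) (a₂ := w) (by simpa using h)]
  lt_par := by
    rintro (_ | ⟨i, v⟩) hv
    · exact (hv rfl).elim
    · have hle := T.le_root v
      by_cases h : v = T.root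
      · subst h
        fin_cases i <;> simp <;> omega
      · have := T.lt_par v h
        simpa [h] using this
  le_root := by
    rintro (_ | ⟨i, v⟩)
    · exact le_rfl
    · have hle := T.le_root v
      fin_cases i <;> simp <;> omega
  adj_iff := by
    rintro (_ | ⟨i, v⟩) (_ | ⟨j, w⟩)
    · simp [SimpleGraph.tripleJoin]
    · by_cases h : w = T.root <;> simp [SimpleGraph.tripleJoin, h]
    · by_cases h : v = T.root <;> simp [SimpleGraph.tripleJoin, h]
    · simp only [SimpleGraph.tripleJoin, T.adj_iff]
      by_cases hv : v = T.root <;> by_cases hw : w = T.root <;> simp [hv, hw] <;> grind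
  laminar := by
    rintro (_ | ⟨i, v⟩) (_ | ⟨j, w⟩) hc hu h1 h2
    · exact le_rfl
    · exact (hc rfl).elim
    · exact (hu rfl).elim
    · have hrw := T.le_root w
      have hrv := T.le_root v
      have hpw := T.le_root (T.par w)
      have hpv := T.le_root (T.par v)
      by_cases hv : v = T.root
      · by_cases hw : w = T.root
        · simp [hv, hw]
        · simp only [hv, hw, if_true, if_false]
          fin_cases j <;> simp <;> omega
      · have hij : i = j := by
          simp only [hv, if_false] at h1 h2
          fin_cases i <;> fin_cases j <;> simp at h1 h2 ⊢ <;> omega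
        subst hij
        simp only [hv, if_false, Nat.add_lt_add_iff_left] at h1 h2 ⊢
        have hw : w ≠ T.root := by rintro rfl; omega
        simpa [hw] using T.laminar v w hv hw h1 h2

theorem hasLargeBags_legGraph (T : G.PostOrder) (L : V → ℕ) {n : ℕ} (h : G.HasLargeBags n) :
    (T.legGraph L).HasLargeBags n := by
  have hadj : ∀ v (hv : v ≠ T.root), (T.legGraph L).Adj ⟨(v, L v), le_rfl⟩
      ⟨(T.par v, 0), Nat.zero_le _⟩ := fun v hv => by simp [legGraph_adj, hv]
  refine h.of_contraction (fun x => x.1.1) (fun v => ?_) fun a b hab => ?_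
  · have key : ∀ i (hi : i ≤ L v), ((T.legGraph L).induce
        ((fun x : {x : V × ℕ // x.2 ≤ L x.1} => x.1.1) ⁻¹' {v})).Reachable
        ⟨⟨(v, i), hi⟩, rfl⟩ ⟨⟨(v, 0), Nat.zero_le _⟩, rfl⟩ := by
      intro i
      induction i with
      | zero => exact fun _ => Reachable.refl _
      | succ i ih =>
        intro hi
        refine Reachable.trans (Adj.reachable ?_) (ih (by omega))
        simp [legGraph_adj]
    rintro ⟨⟨⟨x, i⟩, hi⟩, rfl⟩ ⟨⟨⟨y, j⟩, hj⟩, hy⟩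
    obtain rfl : y = x := hy
    exact (key i hi).trans (key j hj).symm
  · rcases (T.adj_iff a b).1 hab with ⟨h, rfl⟩ | ⟨h, rfl⟩
    · exact ⟨_, _, rfl, rfl, hadj _ h⟩
    · exact ⟨_, _, rfl, rfl, (hadj _ h).symm⟩

/-- The trees are obtained from a single edge by iterating the triple join. -/
theorem exists_hasLargeBags (n : ℕ) : ∃ (V : Type) (_ : Finite V) (G : SimpleGraph V),
    Nonempty G.PostOrder ∧ G.HasLargeBags (n + 2) := by
  induction n with
  | zero =>
    refine ⟨Bool, inferInstance, ⊤, ⟨⟨true, fun _ => true, Bool.toNat, ?_, ?_, ?_, ?_, ?_⟩⟩, ?_⟩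
    · decide
    · decide
    · decide
    · decide
    · decide
    · intro ℓ X hX
      obtain ⟨i, h1, h2⟩ := hX.1 true false (by simp)
      exact ⟨i, Finset.one_lt_card.2 ⟨true, h1, false, h2, by simp⟩⟩
  | succ n ih =>
    obtain ⟨V, _, G, ⟨T⟩, h⟩ := ih
    exact ⟨_, inferInstance, G.tripleJoin T.root, ⟨T.tripleJoin⟩,
      h.tripleJoin (by omega) T.preconnected T.root⟩

end PostOrder

/-- The component `G` is searched first, and then the complete component is inspected as a whole. -/
theorem Searchable.sum_top {k : ℕ} (h : G.Searchable k) {m : ℕ} (hm : m ≤ k) :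
    (G ⊕g (⊤ : SimpleGraph (Fin m))).Searchable k := by
  classical
  obtain ⟨ℓ, S, hS, H⟩ := h
  refine ⟨ℓ + 1, fun t => if t < ℓ then (S t).map Function.Embedding.inl
    else Finset.univ.map Function.Embedding.inr, fun t _ => ?_, fun p hp => ?_⟩
  · dsimp only
    split_ifs with h
    · simpa using hS t h
    · simpa using hm
  · rcases h0 : p 0 with a | a
    · have hleft : ∀ t, ∃ v, p t = Sum.inl v := by
        intro t
        induction t with
        | zero => exact ⟨a, h0⟩
        | succ t ih =>
          obtain ⟨v, hv⟩ := ih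
          rcases hp t with e | e
          · exact ⟨v, e.trans hv⟩
          · rw [hv] at e
            rcases h : p (t + 1) with w | w
            · exact ⟨w, rfl⟩
            · rw [h] at e; simp at e
      choose q hq using hleft
      obtain ⟨t, ht, hqt⟩ := H q fun t => by simpa [hq] using hp t
      exact ⟨t, by omega, by simp [ht, hq, hqt]⟩
    · have hright : ∀ t, ∃ v, p t = Sum.inr v := by
        intro t
        induction t with
        | zero => exact ⟨a, h0⟩
        | succ t ih =>
          obtain ⟨v, hv⟩ := ih
          rcases hp t with e | e
          · exact ⟨v, e.trans hv⟩
          · rw [hv] at e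
            rcases h : p (t + 1) with w | w
            · rw [h] at e; simp at e
            · exact ⟨w, rfl⟩
      obtain ⟨v, hv⟩ := hright ℓ
      exact ⟨ℓ, by omega, by simp [hv]⟩

/-- In a complete graph, the intruder always has somewhere to go next. -/
theorem Searchable.le_of_top {k m : ℕ} (f : (⊤ : SimpleGraph (Fin m)) →g G)
    (hf : Function.Injective f) (h : G.Searchable k) : m ≤ k := by
  classical
  obtain ⟨ℓ, S, hS, H⟩ := h
  by_contra! hk
  have : ∀ t, ∃ a, t < ℓ → f a ∉ S t := by
    intro t
    by_cases ht : t < ℓ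
    · by_contra! hcon
      have := Finset.card_le_card (s := Finset.univ.image f) (t := S t) fun x hx => by
        obtain ⟨a, -, rfl⟩ := Finset.mem_image.1 hx
        exact (hcon a).2
      rw [Finset.card_image_of_injective _ hf, Finset.card_univ, Fintype.card_fin] at this
      have := hS t ht
      omega
    · exact ⟨⟨0, by omega⟩, fun h => (ht h).elim⟩
  choose a ha using this
  obtain ⟨t, ht, hmem⟩ := H (fun t => f (a t)) fun t => by
    by_cases h : a (t + 1) = a t
    · exact Or.inl (by rw [h])
    · exact Or.inr (f.map_adj (by simpa using Ne.symm h))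
  exact ha t ht hmem

theorem Searchable.of_iso {k : ℕ} (e : G ≃g H) (h : G.Searchable k) : H.Searchable k := by
  obtain ⟨ℓ, S, hS, hp⟩ := h
  refine ⟨ℓ, fun t => (S t).map e.toEquiv.toEmbedding, by simpa using hS, fun p hmove => ?_⟩
  obtain ⟨t, ht, hmem⟩ := hp (fun t => e.symm (p t)) fun t => by
    simpa [e.symm.map_adj_iff] using hmove t
  exact ⟨t, ht, Finset.mem_map.2 ⟨_, hmem, by simp⟩⟩

/-- A triangle is added as a further component to make three inspected vertices necessary. -/
theorem exists_inspectionNumber_eq_three_le_pathwidth (n : ℕ) :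
    ∃ (m : ℕ) (H : SimpleGraph (Fin m)), H.inspectionNumber = 3 ∧ n ≤ H.pathwidth := by
  obtain ⟨V, _, G, ⟨T⟩, hG⟩ := PostOrder.exists_hasLargeBags n
  have := Fintype.ofFinite V
  set L := T.geomLength 0
  have hfin : Finite {x : V × ℕ // x.2 ≤ L x.1} :=
    (T.isSubdivisionVia_legGraph (T.geomLength_root 0)).finite
  have := Fintype.ofFinite {x : V × ℕ // x.2 ≤ L x.1}
  have hs : (T.legGraph L).Searchable 3 :=
    T.searchable_legGraph (T.geomLength_sum_le 0) (T.geomLength_root 0)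
  let e := (T.legGraph L ⊕g (⊤ : SimpleGraph (Fin 3))).overFinIso rfl
  refine ⟨_, _, le_antisymm ((hs.sum_top le_rfl).of_iso e).inspectionNumber_le ?_, ?_⟩
  · refine le_iInf₂ fun k hk => ?_
    have : 3 ≤ k := hk.le_of_top (e.toHom.comp Embedding.sumInr.toHom)
      (e.injective.comp Sum.inr_injective)
    exact_mod_cast this
  · refine HasLargeBags.le_pathwidth ?_
    have h := T.hasLargeBags_legGraph L hG
    have h' := h.of_injective (e.toHom.comp Embedding.sumInl.toHom)
      (e.injective.comp Sum.inl_injective)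
    intro ℓ X hX
    obtain ⟨i, hi⟩ := h' ℓ X hX
    exact ⟨i, by omega⟩

end SimpleGraph

/-! ### Inspection numbers of subdivided trees -/

theorem mainTheorem5 :
    (∀ (V : Type u) [Finite V] (T : SimpleGraph V), T.IsTree → T.topInspectionNumber ≤ 3) ∧
    (∀ (V : Type u) [Finite V] (T : SimpleGraph V), T.IsTree → ∀ ℓ : ℕ,
      ∃ (W : Type u) (H : SimpleGraph W) (φ : V → W),
        T.IsSubdivisionVia H φ ∧ T.EdgesSubdivided H φ ℓ ∧ H.inspectionNumber ≤ 3) ∧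
    (∀ n : ℕ, ∃ (m : ℕ) (H : SimpleGraph (Fin m)), H.inspectionNumber = 3 ∧ n ≤ H.pathwidth) := by
  refine ⟨fun V _ T hT => ?_, fun V _ T hT ℓ => ?_,
    SimpleGraph.exists_inspectionNumber_eq_three_le_pathwidth⟩
  · refine iInf₂_le 3 fun W H ⟨φ, hH⟩ => ?_
    obtain ⟨P⟩ := hT.nonempty_postOrder
    obtain ⟨Q⟩ := P.nonempty_of_isSubdivisionVia hH
    have := hH.finite
    exact ⟨_, Q.legGraph (Q.geomLength 0), ⟨_, Q.isSubdivisionVia_legGraph (Q.geomLength_root 0)⟩,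
      Q.inspectionNumber_legGraph_le 0⟩
  · obtain ⟨P⟩ := hT.nonempty_postOrder
    exact ⟨_, P.legGraph (P.geomLength ℓ), _, P.isSubdivisionVia_legGraph (P.geomLength_root ℓ),
      P.edgesSubdivided_legGraph fun u hu => P.le_geomLength hu, P.inspectionNumber_legGraph_le ℓ⟩
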